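/- For every $\alpha\in(0,1)$ there exist constants $\eta\in(0,1)$ and $0<\rho_1<\rho_2<1$, depending only on $\alpha$, with the following property. Let $\Omega\subseteq\mathbb{R}^3$ be open and let $u\in W^{1,2}(\Omega)$ with $e^u\in L^1(\Omega)$ be a weak solution of $-\Delta u=e^u$ in $\Omega$, that is, $-\int_\Omega u\,\Delta\varphi\,dx=\int_\Omega e^u\varphi\,dx$ for all $\varphi\in C_c^\infty(\Omega)$. Let $x_0\in\Omega$ and $0<r<d(x_0,\partial\Omega)$ (with $d(x_0,\emptyset)=\infty$), write $B_s=B(x_0,s)$, and put $$\mathcal{E}_{r,x_0}(u)=\frac1r\int_{B_r}|\nabla u|^2\,dx+\frac1r\int_{B_r}e^u\,dx .$$ If $\mathcal{E}_{r,x_0}(u)\le\eta$, then $$\frac{1}{\rho r}\int_{B_{\rho r}}e^u\,dx\le\alpha\,\mathcal{E}_{r,x_0}(u)\qquad\text{for every }\rho\in[\rho_1,\rho_2].$$ -/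

import Mathlib

open MeasureTheory
open scoped ContDiff

noncomputable section

/-- Three-dimensional Euclidean space. -/
abbrev R3 : Type := EuclideanSpace ℝ (Fin 3)

/-- `φ` is a test function on the open set `Ω`, that is, `φ ∈ C_c^∞(Ω)`. -/
def IsTestFun (Ω : Set R3) (φ : R3 → ℝ) : Prop :=
  ContDiff ℝ ∞ φ ∧ HasCompactSupport φ ∧ tsupport φ ⊆ Ω

/-- `G` is a weak (distributional) gradient of `u` on `Ω`: for every test function `φ` and every
coordinate direction `i`, `∫_Ω u ∂_i φ = - ∫_Ω G_i φ`. -/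
def IsWeakGrad (Ω : Set R3) (u : R3 → ℝ) (G : R3 → R3) : Prop :=
  ∀ φ : R3 → ℝ, IsTestFun Ω φ → ∀ i : Fin 3,
    ∫ x in Ω, u x * fderiv ℝ φ x (EuclideanSpace.single i 1) = -∫ x in Ω, G x i * φ x

/-- `u ∈ W^{1,2}(Ω)` with `∇u = G`; the weak gradient `G` is determined by `u` up to a null set
of `Ω`. -/
structure IsW12 (Ω : Set R3) (u : R3 → ℝ) (G : R3 → R3) : Prop where
  memLp : MemLp u 2 (volume.restrict Ω)
  memLp_grad : MemLp G 2 (volume.restrict Ω)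
  weakGrad : IsWeakGrad Ω u G

/-- `u` is a weak solution of `-Δu = e^u` in `Ω`: for every test function `φ`,
`-∫_Ω u Δφ = ∫_Ω e^u φ`. -/
def IsWeakLiouville (Ω : Set R3) (u : R3 → ℝ) : Prop :=
  ∀ φ : R3 → ℝ, IsTestFun Ω φ →
    -∫ x in Ω, u x * Laplacian.laplacian φ x = ∫ x in Ω, Real.exp (u x) * φ x

/-- The rescaled energy `(1/r) ∫_{B_r(x₀)} |∇u|² + (1/r) ∫_{B_r(x₀)} e^u` of a function `u` with
gradient `G`. -/
def energy (r : ℝ) (x₀ : R3) (u : R3 → ℝ) (G : R3 → R3) : ℝ :=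
  1 / r * (∫ x in Metric.ball x₀ r, ‖G x‖ ^ 2) + 1 / r * ∫ x in Metric.ball x₀ r, Real.exp (u x)

end

/-! The proof needs only the weak equation, Chebyshev and Poincaré. Write E for the energy.
Chebyshev for e^u gives a level m, with e^m comparable to E/r², such that u ≤ m on at least half of
the ball of radius r/2. A smooth step T of u, rising from 0 at m to 1 at m + K, vanishes there, so
Poincaré bounds ∫ T² by C r²/K² ∫ |∇u|². Testing the equation with T times a cutoff bounds ∫ e^u T
on the ball of radius r/4 by (C/K) ∫ |∇u|². Both bounds are `exists_truncation_bounds`.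

Now split e^u according to u ≤ m + 1, m + 1 ≤ u ≤ m + K and u ≥ m + K (`exp_le_add_smoothStep`). On
the ball of radius ρr the three ranges contribute, after rescaling, multiples of ρ²E, e^K E²/ρ and
E/(Kρ) (`exists_decay_bound`). Taking ρ of order α, then K of order α⁻², then η small compared with
α² e^{-K}, makes each at most αE/3.

Since T(u) is not smooth, u is replaced by mollifications U_n. Their a.e. convergence and a uniform
L² bound on ∇U_n suffice (`IsW12.exists_smooth_approx`); convergence of gradients is never used. -/

open Set Filter Metric Topology Real
open scoped ENNReal Convolution RealInnerProductSpace

/-! ### Poincaré's inequality for smooth functions on convex sets -/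

section Poincare

lemma lintegral_comp_affine (a : R3) {t : ℝ} (ht : 0 < t) (h : R3 → ℝ≥0∞) (hh : Measurable h) :
    ∫⁻ y, h (a + t • y) = ENNReal.ofReal (t ^ 3)⁻¹ * ∫⁻ z, h z := by
  have h1 : ∫⁻ y, h (a + t • y) = ∫⁻ z, h (a + z) ∂(Measure.map (t • ·) (volume : Measure R3)) := by
    rw [lintegral_map (by fun_prop) (by fun_prop)]
  rw [h1, Measure.map_addHaar_smul volume ht.ne', lintegral_smul_measure, smul_eq_mul,
    lintegral_add_left_eq_self (fun z => h z) a]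
  simp [abs_of_pos ht]

/-- Averaging a nonnegative function over the points `x + t (y - x)` of a convex set. -/
lemma lintegral_lintegral_segment_le_of_half_le {s : Set R3} (hs : Convex ℝ s)
    (hsm : MeasurableSet s) (h : R3 → ℝ≥0∞) (hh : Measurable h) {t : ℝ} (ht : 1 / 2 ≤ t)
    (ht1 : t ≤ 1) :
    ∫⁻ x in s, ∫⁻ y in s, h ((1 - t) • x + t • y) ≤ 8 * volume s * ∫⁻ z in s, h z := by
  have key : ∀ x ∈ s, ∫⁻ y in s, h ((1 - t) • x + t • y) ≤ 8 * ∫⁻ z in s, h z := by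
    intro x hx
    calc ∫⁻ y in s, h ((1 - t) • x + t • y)
        ≤ ∫⁻ y in s, s.indicator h ((1 - t) • x + t • y) := by
          refine setLIntegral_mono' hsm fun y hy => ?_
          rw [indicator_of_mem (hs hx hy (by linarith) (by linarith) (by ring))]
      _ ≤ ∫⁻ y, s.indicator h ((1 - t) • x + t • y) := setLIntegral_le_lintegral _ _
      _ = ENNReal.ofReal (t ^ 3)⁻¹ * ∫⁻ z in s, h z := by
          rw [lintegral_comp_affine _ (by linarith) _ (hh.indicator hsm), lintegral_indicator hsm]
      -- The Jacobian t⁻³ is at most 8 because t ≥ 1/2.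
      _ ≤ 8 * ∫⁻ z in s, h z := by
          gcongr
          rw [← ENNReal.ofReal_ofNat]
          apply ENNReal.ofReal_le_ofReal
          rw [inv_le_comm₀ (by positivity) (by norm_num)]
          calc (8 : ℝ)⁻¹ = (1 / 2) ^ 3 := by norm_num
            _ ≤ t ^ 3 := by gcongr
  calc _ ≤ ∫⁻ x in s, 8 * ∫⁻ z in s, h z := setLIntegral_mono' hsm key
    _ = _ := by rw [setLIntegral_const]; ring

/-- For t < 1/2 the Jacobian in y degenerates; exchanging the roles of x and y replaces t by 1 - t.
-/
lemma lintegral_lintegral_segment_le {s : Set R3} (hs : Convex ℝ s)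
    (hsm : MeasurableSet s) (h : R3 → ℝ≥0∞) (hh : Measurable h) {t : ℝ} (ht : t ∈ Icc (0 : ℝ) 1) :
    ∫⁻ x in s, ∫⁻ y in s, h ((1 - t) • x + t • y) ≤ 8 * volume s * ∫⁻ z in s, h z := by
  rcases le_total (1 / 2) t with h2 | h2
  · exact lintegral_lintegral_segment_le_of_half_le hs hsm h hh h2 ht.2
  · have := lintegral_lintegral_segment_le_of_half_le hs hsm h hh (t := 1 - t) (by linarith)
      (by linarith [ht.1])
    rw [lintegral_lintegral_swap (by fun_prop)]
    simpa [add_comm] using this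

/-- Fundamental theorem of calculus along the segment, then Cauchy–Schwarz in t, obtained from the
nonnegativity of a variance. -/
lemma ofReal_sub_sq_le_lintegral_segment {v : R3 → ℝ} (hv : ContDiff ℝ 1 v) {d : ℝ} {x y : R3}
    (hd : dist x y ≤ d) :
    ENNReal.ofReal ((v x - v y) ^ 2) ≤ ENNReal.ofReal (d ^ 2) *
      ∫⁻ t in Icc (0 : ℝ) 1, ENNReal.ofReal (‖fderiv ℝ v ((1 - t) • x + t • y)‖ ^ 2) := by
  have hfd : Continuous (fderiv ℝ v) := hv.continuous_fderiv one_ne_zero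
  set g : ℝ → ℝ := fun t => fderiv ℝ v ((1 - t) • x + t • y) (y - x) with hg
  have hgc : Continuous g := by fun_prop
  have hder : ∀ t : ℝ, HasDerivAt (fun t : ℝ => v ((1 - t) • x + t • y)) (g t) t := by
    intro t
    have h1 : HasDerivAt (fun t : ℝ => (1 - t) • x + t • y) (y - x) t := by
      have := (((hasDerivAt_id t).const_sub 1).smul_const x).add ((hasDerivAt_id t).smul_const y)
      rw [show y - x = (-1 : ℝ) • x + (1 : ℝ) • y by simp; abel]
      exact this
    exact ((hv.differentiable one_ne_zero _).hasFDerivAt).comp_hasDerivAt t h1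
  have hint : ∫ t in (0 : ℝ)..1, g t = v y - v x := by
    rw [intervalIntegral.integral_eq_sub_of_hasDerivAt (fun t _ => hder t)
      (hgc.intervalIntegrable _ _)]
    simp
  have hsq : (v y - v x) ^ 2 ≤ ∫ t in (0 : ℝ)..1, g t ^ 2 := by
    have h0 : 0 ≤ ∫ t in (0 : ℝ)..1, (g t - (v y - v x)) ^ 2 :=
      intervalIntegral.integral_nonneg zero_le_one fun t _ => sq_nonneg _
    have h1 : ∫ t in (0 : ℝ)..1, (g t - (v y - v x)) ^ 2 =
        (∫ t in (0 : ℝ)..1, g t ^ 2) - (∫ t in (0 : ℝ)..1, 2 * (v y - v x) * g t)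
          + ∫ t in (0 : ℝ)..1, (v y - v x) ^ 2 := by
      rw [← intervalIntegral.integral_sub, ← intervalIntegral.integral_add]
      · congr 1; ext t; ring
      all_goals apply Continuous.intervalIntegrable; fun_prop
    rw [h1, intervalIntegral.integral_const_mul, hint, intervalIntegral.integral_const] at h0
    simp only [sub_zero, smul_eq_mul, one_mul] at h0
    nlinarith
  have hle : ∫ t in (0 : ℝ)..1, g t ^ 2 ≤
      ∫ t in Icc (0 : ℝ) 1, d ^ 2 * ‖fderiv ℝ v ((1 - t) • x + t • y)‖ ^ 2 := by
    rw [intervalIntegral.integral_of_le zero_le_one, integral_Icc_eq_integral_Ioc]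
    refine setIntegral_mono_on ?_ ?_ measurableSet_Ioc fun t _ => ?_
    · exact (Continuous.integrableOn_Icc (by fun_prop)).mono_set Ioc_subset_Icc_self
    · exact (Continuous.integrableOn_Icc (by fun_prop)).mono_set Ioc_subset_Icc_self
    · rw [← sq_abs, ← mul_pow]
      gcongr
      calc |g t| ≤ ‖fderiv ℝ v ((1 - t) • x + t • y)‖ * ‖y - x‖ :=
            (fderiv ℝ v ((1 - t) • x + t • y)).le_opNorm (y - x)
        _ ≤ _ := by
            rw [mul_comm]; gcongr; rwa [← dist_eq_norm, dist_comm]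
  rw [← lintegral_const_mul _ (by fun_prop)]
  calc _ ≤ ENNReal.ofReal (∫ t in Icc (0 : ℝ) 1,
        d ^ 2 * ‖fderiv ℝ v ((1 - t) • x + t • y)‖ ^ 2) := by
        apply ENNReal.ofReal_le_ofReal; rw [sub_sq_comm]; exact hsq.trans hle
    _ = _ := by
        rw [ofReal_integral_eq_lintegral_ofReal (Continuous.integrableOn_Icc (by fun_prop))
          (ae_of_all _ fun t => by positivity)]
        simp_rw [ENNReal.ofReal_mul (sq_nonneg d)]

/-- Poincaré's inequality on a bounded convex set, in the symmetric form. -/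
lemma lintegral_lintegral_sub_sq_le {s : Set R3} (hs : Convex ℝ s) (hsm : MeasurableSet s)
    {d : ℝ} (hd : ∀ x ∈ s, ∀ y ∈ s, dist x y ≤ d) {v : R3 → ℝ} (hv : ContDiff ℝ 1 v) :
    ∫⁻ x in s, ∫⁻ y in s, ENNReal.ofReal ((v x - v y) ^ 2) ≤
      ENNReal.ofReal (d ^ 2) * (8 * volume s * ∫⁻ z in s, ENNReal.ofReal (‖fderiv ℝ v z‖ ^ 2)) := by
  have hfd : Continuous (fderiv ℝ v) := hv.continuous_fderiv one_ne_zero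
  set h : R3 → ℝ≥0∞ := fun z => ENNReal.ofReal (‖fderiv ℝ v z‖ ^ 2) with hh
  have hhc : Continuous h := ENNReal.continuous_ofReal.comp (by fun_prop)
  have hhm : Measurable h := hhc.measurable
  calc ∫⁻ x in s, ∫⁻ y in s, ENNReal.ofReal ((v x - v y) ^ 2)
      ≤ ∫⁻ x in s, ∫⁻ y in s, ENNReal.ofReal (d ^ 2) *
          ∫⁻ t in Icc (0 : ℝ) 1, h ((1 - t) • x + t • y) :=
        setLIntegral_mono' hsm fun x hx => setLIntegral_mono' hsm fun y hy =>
          ofReal_sub_sq_le_lintegral_segment hv (hd x hx y hy)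
    _ = ENNReal.ofReal (d ^ 2) * ∫⁻ x in s, ∫⁻ y in s,
          ∫⁻ t in Icc (0 : ℝ) 1, h ((1 - t) • x + t • y) := by
        simp_rw [lintegral_const_mul' _ _ ENNReal.ofReal_ne_top]
    -- Tonelli moves t outermost, so that the averaging bound applies for each fixed t.
    _ = ENNReal.ofReal (d ^ 2) * ∫⁻ t in Icc (0 : ℝ) 1, ∫⁻ x in s, ∫⁻ y in s,
          h ((1 - t) • x + t • y) := by
        congr 1
        have h1 : ∀ x, ∫⁻ y in s, ∫⁻ t in Icc (0 : ℝ) 1, h ((1 - t) • x + t • y) =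
            ∫⁻ t in Icc (0 : ℝ) 1, ∫⁻ y in s, h ((1 - t) • x + t • y) := fun x =>
          lintegral_lintegral_swap (by fun_prop)
        simp_rw [h1]
        refine lintegral_lintegral_swap (Measurable.aemeasurable ?_)
        have h2 : Measurable fun p : (R3 × ℝ) × R3 => h ((1 - p.1.2) • p.1.1 + p.1.2 • p.2) := by
          fun_prop
        exact h2.lintegral_prod_right'
    _ ≤ ENNReal.ofReal (d ^ 2) * ∫⁻ t in Icc (0 : ℝ) 1, 8 * volume s * ∫⁻ z in s, h z :=
        mul_le_mul' le_rfl (setLIntegral_mono' measurableSet_Icc fun t ht =>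
          lintegral_lintegral_segment_le hs hsm h hhm ht)
    _ = _ := by simp

end Poincare

/-! ### Weak gradients and the once-integrated equation -/

section WeakFormulation

lemma clm_apply_eq_sum (A : R3 →L[ℝ] ℝ) (w : R3) :
    A w = ∑ i, w i * A (EuclideanSpace.single i 1) := by
  conv_lhs => rw [← (EuclideanSpace.basisFun (Fin 3) ℝ).sum_repr w]
  simp

lemma IsTestFun.hasCompactSupport_fderiv_apply {Ω : Set R3} {φ : R3 → ℝ} (h : IsTestFun Ω φ)
    (w : R3) : HasCompactSupport fun x => fderiv ℝ φ x w :=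
  h.2.1.fderiv_apply (𝕜 := ℝ) w

lemma IsTestFun.continuous_fderiv_apply {Ω : Set R3} {φ : R3 → ℝ} (h : IsTestFun Ω φ)
    (w : R3) : Continuous fun x => fderiv ℝ φ x w :=
  (h.1.continuous_fderiv (by simp)).clm_apply continuous_const

lemma IsTestFun.fderiv_apply {Ω : Set R3} {φ : R3 → ℝ} (h : IsTestFun Ω φ) (w : R3) :
    IsTestFun Ω fun x => fderiv ℝ φ x w :=
  ⟨(h.1.fderiv_right (m := ∞) (by simp)).clm_apply contDiff_const,
    h.hasCompactSupport_fderiv_apply w, (tsupport_fderiv_apply_subset ℝ w).trans h.2.2⟩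

lemma integrableOn_mul_continuous {Ω : Set R3} {f : R3 → ℝ}
    (hf : MemLp f 2 (volume.restrict Ω)) {ψ : R3 → ℝ} (hψ : Continuous ψ)
    (hc : HasCompactSupport ψ) : IntegrableOn (fun x => f x * ψ x) Ω :=
  hf.integrable_mul (q := 2) (hψ.memLp_of_hasCompactSupport hc)

lemma memLp_coord {Ω : Set R3} {G : R3 → R3} (hG : MemLp G 2 (volume.restrict Ω)) (i : Fin 3) :
    MemLp (fun x => G x i) 2 (volume.restrict Ω) :=
  (EuclideanSpace.proj (𝕜 := ℝ) i : R3 →L[ℝ] ℝ).comp_memLp' hG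

/-- The weak gradient in an arbitrary direction. -/
lemma IsW12.integral_mul_fderiv {Ω : Set R3} {u : R3 → ℝ} {G : R3 → R3} (h : IsW12 Ω u G)
    {φ : R3 → ℝ} (hφ : IsTestFun Ω φ) (w : R3) :
    ∫ x in Ω, u x * fderiv ℝ φ x w = -∫ x in Ω, ⟪G x, w⟫ * φ x := by
  have h1 : ∀ x, u x * fderiv ℝ φ x w =
      ∑ i, w i * (u x * fderiv ℝ φ x (EuclideanSpace.single i 1)) := fun x => by
    rw [clm_apply_eq_sum, Finset.mul_sum]
    exact Finset.sum_congr rfl fun i _ => by ring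
  have h2 : ∀ x, ⟪G x, w⟫ * φ x = ∑ i, w i * (G x i * φ x) := fun x => by
    rw [PiLp.inner_apply, Finset.sum_mul]
    exact Finset.sum_congr rfl fun i _ => by simp; ring
  simp_rw [h1, h2]
  rw [integral_finsetSum, integral_finsetSum, ← Finset.sum_neg_distrib]
  · refine Finset.sum_congr rfl fun i _ => ?_
    rw [integral_const_mul, integral_const_mul, h.weakGrad φ hφ i]
    ring
  · exact fun i _ =>
      (integrableOn_mul_continuous (memLp_coord h.memLp_grad i) hφ.1.continuous hφ.2.1).const_mul _
  · exact fun i _ => (integrableOn_mul_continuous h.memLp (hφ.continuous_fderiv_apply _)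
      (hφ.hasCompactSupport_fderiv_apply _)).const_mul _

lemma laplacian_eq_sum_fderiv {φ : R3 → ℝ} (hφ : ContDiff ℝ ∞ φ) (x : R3) :
    Laplacian.laplacian φ x = ∑ i : Fin 3,
      fderiv ℝ (fun y => fderiv ℝ φ y (EuclideanSpace.single i 1)) x
        (EuclideanSpace.single i 1) := by
  have hd : DifferentiableAt ℝ (fderiv ℝ φ) x :=
    (hφ.fderiv_right (m := 1) (by norm_cast)).differentiable one_ne_zero x
  rw [InnerProductSpace.laplacian_eq_iteratedFDeriv_orthonormalBasis φ
    (EuclideanSpace.basisFun (Fin 3) ℝ)]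
  refine Finset.sum_congr rfl fun i _ => ?_
  rw [iteratedFDeriv_two_apply, fderiv_clm_apply hd (differentiableAt_const _)]
  simp

/-- The weak equation, integrated by parts once. -/
lemma IsW12.integral_fderiv_apply_grad {Ω : Set R3} {u : R3 → ℝ} {G : R3 → R3} (h : IsW12 Ω u G)
    (hL : IsWeakLiouville Ω u) {φ : R3 → ℝ} (hφ : IsTestFun Ω φ) :
    ∫ x in Ω, fderiv ℝ φ x (G x) = ∫ x in Ω, exp (u x) * φ x := by
  rw [← hL φ hφ]
  simp_rw [laplacian_eq_sum_fderiv hφ.1, clm_apply_eq_sum _ (G _), Finset.mul_sum]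
  rw [integral_finsetSum, integral_finsetSum, ← Finset.sum_neg_distrib]
  · refine Finset.sum_congr rfl fun i _ => ?_
    rw [h.weakGrad _ (hφ.fderiv_apply _) i, neg_neg]
  · exact fun i _ => integrableOn_mul_continuous h.memLp
      ((hφ.fderiv_apply _).continuous_fderiv_apply _)
      ((hφ.fderiv_apply _).hasCompactSupport_fderiv_apply _)
  · exact fun i _ => integrableOn_mul_continuous (memLp_coord h.memLp_grad i)
      (hφ.continuous_fderiv_apply _) (hφ.hasCompactSupport_fderiv_apply _)

end WeakFormulation

/-! ### Mollification inside a ball -/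

section Mollification

/-- Jensen's inequality for the probability density k, by expanding a variance. -/
lemma sq_integral_mul_le {μ : Measure R3} {k g : R3 → ℝ} (hk : ∀ x, 0 ≤ k x)
    (hk1 : ∫ x, k x ∂μ = 1) (hki : Integrable k μ) (hg : Integrable (fun x => g x * k x) μ)
    (hg2 : Integrable (fun x => g x ^ 2 * k x) μ) :
    (∫ x, g x * k x ∂μ) ^ 2 ≤ ∫ x, g x ^ 2 * k x ∂μ := by
  set a := ∫ x, g x * k x ∂μ with ha
  have h0 : 0 ≤ ∫ x, (g x - a) ^ 2 * k x ∂μ :=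
    integral_nonneg fun x => mul_nonneg (sq_nonneg _) (hk x)
  have h1 : ∫ x, (g x - a) ^ 2 * k x ∂μ =
      (∫ x, g x ^ 2 * k x ∂μ) - (∫ x, 2 * a * (g x * k x) ∂μ) + ∫ x, a ^ 2 * k x ∂μ := by
    rw [← integral_sub hg2 (hg.const_mul _)]
    refine Eq.trans ?_ (integral_add (hg2.sub (hg.const_mul _)) (hki.const_mul _))
    congr 1; ext t; ring
  rw [h1, integral_const_mul, integral_const_mul, ← ha, hk1] at h0
  nlinarith

variable {Ω : Set R3} {u : R3 → ℝ} {G : R3 → R3} {x₀ : R3} {r : ℝ}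

lemma locallyIntegrable_indicator_of_memLp {E : Type*} [NormedAddCommGroup E] {f : R3 → E}
    {s : Set R3} (hs : MeasurableSet s) (hf : MemLp f 2 (volume.restrict s)) :
    LocallyIntegrable (s.indicator f) volume :=
  ((memLp_indicator_iff_restrict hs).2 hf).locallyIntegrable (by norm_num)

/-- For x in the half ball the reflected kernel t ↦ k(x - t) is supported well inside the ball,
hence is a test function, and the derivative falls on u as its weak gradient. Cutting u off outside
the ball is invisible there. -/
lemma IsW12.fderiv_convolution_apply (h : IsW12 Ω u G) (hΩ : IsOpen Ω) (hball : ball x₀ r ⊆ Ω)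
    (χ : ContDiffBump (0 : R3)) (hχ : χ.rOut ≤ r / 4) {x : R3} (hx : x ∈ closedBall x₀ (r / 2))
    (w : R3) :
    fderiv ℝ ((ball x₀ r).indicator u ⋆[ContinuousLinearMap.mul ℝ ℝ] χ.normed volume) x w =
      ∫ t in ball x₀ r, ⟪G t, w⟫ * χ.normed volume (x - t) := by
  set k : R3 → ℝ := χ.normed volume with hk
  have hkc : ContDiff ℝ ∞ k := χ.contDiff_normed
  have hks : HasCompactSupport k := χ.hasCompactSupport_normed
  have hr : 0 < r := by linarith [χ.rOut_pos]
  have hu : LocallyIntegrable ((ball x₀ r).indicator u) volume :=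
    locallyIntegrable_indicator_of_memLp measurableSet_ball
      (h.memLp.mono_measure (Measure.restrict_mono hball le_rfl))
  have hsub : closedBall x χ.rOut ⊆ ball x₀ r :=
    closedBall_subset_ball' (by rw [mem_closedBall] at hx; linarith)
  set φ : R3 → ℝ := fun t => k (x - t) with hφ
  have hφ0 : ∀ t, t ∉ closedBall x χ.rOut → φ t = 0 := by
    intro t ht
    have : x - t ∉ Function.support k := by
      rw [hk, χ.support_normed_eq, mem_ball_zero_iff, ← dist_eq_norm, dist_comm]
      rw [mem_closedBall] at ht
      linarith
    simpa using this
  have hφt : tsupport φ ⊆ closedBall x χ.rOut :=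
    closure_minimal (fun t ht => by_contra fun h' => ht (hφ0 t h')) isClosed_closedBall
  have hφtest : IsTestFun Ω φ :=
    ⟨hkc.comp (contDiff_const.sub contDiff_id),
      (isCompact_closedBall x χ.rOut).of_isClosed_subset (isClosed_tsupport _) hφt,
      hφt.trans (hsub.trans hball)⟩
  have hφd : ∀ t, fderiv ℝ k (x - t) w = -fderiv ℝ φ t w := by
    intro t
    have h1 := ((hkc.differentiable (by simp) (x - t)).hasFDerivAt).comp t
      ((hasFDerivAt_id t).const_sub x)
    have h2 : fderiv ℝ φ t = _ := h1.fderiv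
    rw [h2]; simp
  have hφd0 : ∀ t, t ∉ ball x₀ r → fderiv ℝ φ t w = 0 := by
    intro t ht
    have : fderiv ℝ φ t = 0 := by
      by_contra h0
      exact ht (hsub (hφt (support_fderiv_subset ℝ h0)))
    simp [this]
  rw [(hks.hasFDerivAt_convolution_right _ hu (hkc.of_le (by simp)) x).fderiv,
    convolution_precompR_apply _ hu (hks.fderiv (𝕜 := ℝ)) (hkc.continuous_fderiv (by simp)),
    convolution_def]
  calc ∫ t, (ball x₀ r).indicator u t * fderiv ℝ k (x - t) w
      = ∫ t in ball x₀ r, -(u t * fderiv ℝ φ t w) := by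
        rw [← integral_indicator measurableSet_ball]
        congr 1; ext t
        by_cases ht : t ∈ ball x₀ r <;> simp [ht, hφd]
    _ = -∫ t in Ω, u t * fderiv ℝ φ t w := by
        rw [integral_neg, setIntegral_eq_of_subset_of_forall_sdiff_eq_zero hΩ.measurableSet hball]
        exact fun t ht => by rw [hφd0 t ht.2, mul_zero]
    _ = ∫ t in Ω, ⟪G t, w⟫ * φ t := by rw [h.integral_mul_fderiv hφtest w, neg_neg]
    _ = ∫ t in ball x₀ r, ⟪G t, w⟫ * φ t := by
        rw [setIntegral_eq_of_subset_of_forall_sdiff_eq_zero hΩ.measurableSet hball]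
        exact fun t ht => by rw [hφ0 t fun h' => ht.2 (hsub h'), mul_zero]

/-- Pointwise, |∇(u * k)|² ≤ (|G| * k)² ≤ |G|² * k by Jensen, and convolution with k preserves total
mass. -/
lemma IsW12.lintegral_fderiv_convolution_sq_le (h : IsW12 Ω u G) (hΩ : IsOpen Ω)
    (hball : ball x₀ r ⊆ Ω) (χ : ContDiffBump (0 : R3)) (hχ : χ.rOut ≤ r / 4) :
    ∫⁻ x in closedBall x₀ (r / 2), ENNReal.ofReal
      (‖fderiv ℝ ((ball x₀ r).indicator u ⋆[ContinuousLinearMap.mul ℝ ℝ] χ.normed volume) x‖ ^ 2)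
      ≤ ENNReal.ofReal (∫ x in ball x₀ r, ‖G x‖ ^ 2) := by
  set k : R3 → ℝ := χ.normed volume with hk
  have hkc : Continuous k := χ.continuous_normed
  have hks : HasCompactSupport k := χ.hasCompactSupport_normed
  have hk0 : ∀ x, 0 ≤ k x := χ.nonneg_normed
  have hki : Integrable k := χ.integrable_normed
  have hk1 : ∫ x, k x = 1 := χ.integral_normed
  have hGr : MemLp G 2 (volume.restrict (ball x₀ r)) :=
    h.memLp_grad.mono_measure (Measure.restrict_mono hball le_rfl)
  set g : R3 → ℝ := (ball x₀ r).indicator fun t => ‖G t‖ with hg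
  have hgl : LocallyIntegrable g volume :=
    locallyIntegrable_indicator_of_memLp measurableSet_ball hGr.norm
  have hg2 : ∀ t, g t ^ 2 = (ball x₀ r).indicator (fun t => ‖G t‖ ^ 2) t := by
    intro t; by_cases ht : t ∈ ball x₀ r <;> simp [hg, ht]
  have hg2i : Integrable fun t => g t ^ 2 := by
    simp_rw [hg2]
    exact (integrable_indicator_iff measurableSet_ball).2 (hGr.integrable_norm_pow two_ne_zero)
  set N : R3 → ℝ := (fun t => g t ^ 2) ⋆[ContinuousLinearMap.mul ℝ ℝ] k with hN
  have hN0 : ∀ x, 0 ≤ N x := fun x =>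
    integral_nonneg fun t => mul_nonneg (sq_nonneg (g t)) (hk0 _)
  have hNi : Integrable N := hg2i.integrable_convolution _ hki
  have hNint : ∫ x, N x = ∫ x in ball x₀ r, ‖G x‖ ^ 2 := by
    rw [hN, integral_convolution _ hg2i hki, hk1]
    simp_rw [hg2]
    rw [integral_indicator measurableSet_ball]
    simp
  have key : ∀ x ∈ closedBall x₀ (r / 2), ‖fderiv ℝ ((ball x₀ r).indicator u
      ⋆[ContinuousLinearMap.mul ℝ ℝ] k) x‖ ^ 2 ≤ N x := by
    intro x hx
    have e1 : Integrable fun t => g t * k (x - t) :=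
      hks.convolutionExists_right (ContinuousLinearMap.mul ℝ ℝ) hgl hkc x
    have e2 : Integrable fun t => g t ^ 2 * k (x - t) :=
      hks.convolutionExists_right (ContinuousLinearMap.mul ℝ ℝ) hg2i.locallyIntegrable hkc x
    have e3 : (∫ t, g t * k (x - t)) ^ 2 ≤ N x :=
      sq_integral_mul_le (fun t => hk0 _) (by rw [integral_sub_left_eq_self, hk1])
        (hki.comp_sub_left x) e1 e2
    have e4 : 0 ≤ ∫ t, g t * k (x - t) :=
      integral_nonneg fun t => mul_nonneg (indicator_nonneg (fun _ _ => norm_nonneg _) t) (hk0 _)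
    refine (pow_le_pow_left₀ (norm_nonneg _) ?_ 2).trans e3
    refine ContinuousLinearMap.opNorm_le_bound _ e4 fun w => ?_
    rw [h.fderiv_convolution_apply hΩ hball χ hχ hx w, ← integral_mul_const,
      ← integral_indicator measurableSet_ball]
    refine norm_integral_le_of_norm_le (e1.mul_const _) (ae_of_all _ fun t => ?_)
    by_cases ht : t ∈ ball x₀ r
    · simp only [ht, indicator_of_mem, hg, norm_mul, Real.norm_of_nonneg (hk0 (x - t)), ← hk]
      calc _ ≤ ‖G t‖ * ‖w‖ * k (x - t) :=
            mul_le_mul_of_nonneg_right (norm_inner_le_norm _ _) (hk0 _)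
        _ = _ := by ring
    · simp [ht, hg]
  calc _ ≤ ∫⁻ x in closedBall x₀ (r / 2), ENNReal.ofReal (N x) :=
        setLIntegral_mono' measurableSet_closedBall fun x hx => ENNReal.ofReal_le_ofReal (key x hx)
    _ ≤ ∫⁻ x, ENNReal.ofReal (N x) := setLIntegral_le_lintegral _ _
    _ = _ := by rw [← ofReal_integral_eq_lintegral_ofReal hNi (ae_of_all _ hN0), hNint]

/-- Interior approximation of a Sobolev function by smooth functions. -/
lemma IsW12.exists_smooth_approx (h : IsW12 Ω u G) (hΩ : IsOpen Ω) (hr : 0 < r)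
    (hball : ball x₀ r ⊆ Ω) :
    ∃ U : ℕ → R3 → ℝ, (∀ n, ContDiff ℝ ∞ (U n)) ∧
      (∀ᵐ x ∂volume.restrict (closedBall x₀ (r / 2)), Tendsto (U · x) atTop (𝓝 (u x))) ∧
      ∀ n, ∫⁻ x in closedBall x₀ (r / 2), ENNReal.ofReal (‖fderiv ℝ (U n) x‖ ^ 2) ≤
        ENNReal.ofReal (∫ x in ball x₀ r, ‖G x‖ ^ 2) := by
  have hu : LocallyIntegrable ((ball x₀ r).indicator u) volume :=
    locallyIntegrable_indicator_of_memLp measurableSet_ball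
      (h.memLp.mono_measure (Measure.restrict_mono hball le_rfl))
  let χ : ℕ → ContDiffBump (0 : R3) := fun n =>
    ⟨r / 4 / (n + 1) / 2, r / 4 / (n + 1), by positivity, half_lt_self (by positivity)⟩
  have hlim : Tendsto (fun n => (χ n).rOut) atTop (𝓝 0) :=
    tendsto_const_nhds.div_atTop (tendsto_atTop_add_const_right _ _ tendsto_natCast_atTop_atTop)
  refine ⟨fun n => (ball x₀ r).indicator u ⋆[ContinuousLinearMap.mul ℝ ℝ] (χ n).normed volume,
    fun n => (χ n).hasCompactSupport_normed.contDiff_convolution_right _ hu (χ n).contDiff_normed,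
    ?_, fun n => h.lintegral_fderiv_convolution_sq_le hΩ hball _ ?_⟩
  -- `K := 2` is the fixed ratio of outer to inner radius in `χ`, which makes the kernels admissible
  -- for Lebesgue differentiation.
  · have := ContDiffBump.ae_convolution_tendsto_right_of_locallyIntegrable (K := 2) hlim
      (Eventually.of_forall fun n => (mul_div_cancel₀ _ two_ne_zero).ge) hu
    rw [ae_restrict_iff' measurableSet_closedBall]
    filter_upwards [this] with x hx hxb
    have hxb' : x ∈ ball x₀ r := closedBall_subset_ball (by linarith) hxb
    rw [indicator_of_mem hxb'] at hx
    refine hx.congr fun n => ?_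
    rw [← convolution_flip]
    congr 1
    ext; simp
  · exact div_le_self (by positivity) (by simp)

end Mollification

/-! ### Smooth truncations, cutoffs, and Poincaré for functions vanishing on half of a set -/

section Truncation

lemma exists_bound_deriv_smoothTransition :
    ∃ L : ℝ, 0 ≤ L ∧ ∀ s, ‖deriv smoothTransition s‖ ≤ L := by
  have hc : Continuous (deriv smoothTransition) :=
    (smoothTransition.contDiff (n := 1)).continuous_deriv le_rfl
  obtain ⟨L, hL⟩ := isCompact_Icc.exists_bound_of_continuousOn (s := Icc (0 : ℝ) 1) hc.continuousOn
  refine ⟨max L 0, le_max_right _ _, fun s => ?_⟩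
  by_cases hs : s ∈ Icc (0 : ℝ) 1
  · exact (hL s hs).trans (le_max_left _ _)
  · suffices deriv smoothTransition s = 0 by simp [this]
    rcases not_and_or.1 hs with h | h
    · have : smoothTransition =ᶠ[𝓝 s] fun _ => 0 := by
        filter_upwards [Iio_mem_nhds (not_le.1 h)] with t ht
        exact smoothTransition.zero_of_nonpos (le_of_lt ht)
      rw [this.deriv_eq, deriv_const]
    · have : smoothTransition =ᶠ[𝓝 s] fun _ => 1 := by
        filter_upwards [Ioi_mem_nhds (not_le.1 h)] with t ht
        exact smoothTransition.one_of_one_le (le_of_lt ht)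
      rw [this.deriv_eq, deriv_const]

/-- A smooth step that vanishes on `(-∞, m]` and equals `1` on `[m + K, ∞)`. -/
noncomputable def smoothStep (m K s : ℝ) : ℝ := smoothTransition ((s - m) / K)

lemma smoothStep_nonneg (m K s : ℝ) : 0 ≤ smoothStep m K s := smoothTransition.nonneg _

lemma smoothStep_le_one (m K s : ℝ) : smoothStep m K s ≤ 1 := smoothTransition.le_one _

lemma smoothStep_eq_zero {m K s : ℝ} (hK : 0 < K) (hs : s ≤ m) : smoothStep m K s = 0 :=
  smoothTransition.zero_of_nonpos (div_nonpos_of_nonpos_of_nonneg (by linarith) hK.le)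

lemma smoothStep_eq_one {m K s : ℝ} (hK : 0 < K) (hs : m + K ≤ s) : smoothStep m K s = 1 :=
  smoothTransition.one_of_one_le ((one_le_div hK).2 (by linarith))

lemma contDiff_smoothStep (m K : ℝ) : ContDiff ℝ ∞ (smoothStep m K) :=
  smoothTransition.contDiff.comp ((contDiff_id.sub contDiff_const).div_const _)

lemma continuous_smoothStep (m K : ℝ) : Continuous (smoothStep m K) :=
  (contDiff_smoothStep m K).continuous

/-- The factor 1/K from spreading the step over width K is the source of all smallness in K. -/
lemma norm_fderiv_smoothStep_comp_le {L : ℝ} (hL : ∀ s, ‖deriv smoothTransition s‖ ≤ L) {m K : ℝ}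
    (hK : 0 < K) {U : R3 → ℝ} {x : R3} (hU : DifferentiableAt ℝ U x) :
    ‖fderiv ℝ (fun y => smoothStep m K (U y)) x‖ ≤ L / K * ‖fderiv ℝ U x‖ := by
  have h1 : HasFDerivAt (fun y => (U y - m) / K) (K⁻¹ • fderiv ℝ U x) x := by
    simpa [div_eq_inv_mul] using (hU.hasFDerivAt.sub_const m).const_mul K⁻¹
  have h2 : HasDerivAt smoothTransition (deriv smoothTransition ((U x - m) / K)) ((U x - m) / K) :=
    ((smoothTransition.contDiff (n := 1)).differentiable one_ne_zero _).hasDerivAt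
  have h3 : fderiv ℝ (fun y => smoothStep m K (U y)) x = _ := (h2.comp_hasFDerivAt x h1).fderiv
  rw [h3, norm_smul, norm_smul, norm_inv, Real.norm_of_nonneg hK.le, div_eq_mul_inv L,
    mul_assoc]
  gcongr
  exact hL _

/-- One fixed bump is rescaled, so M does not depend on the ball. -/
lemma exists_cutoff : ∃ M : ℝ, ∀ (x₀ : R3) (r : ℝ), 0 < r → ∃ φ : R3 → ℝ, ContDiff ℝ ∞ φ ∧
    (∀ x, 0 ≤ φ x) ∧ (∀ x, φ x ≤ 1) ∧ (∀ x ∈ ball x₀ (r / 4), φ x = 1) ∧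
    tsupport φ ⊆ closedBall x₀ (r / 2) ∧ ∀ x, ‖fderiv ℝ φ x‖ ≤ M / r := by
  let χ : ContDiffBump (0 : R3) := ⟨1 / 4, 1 / 2, by norm_num, by norm_num⟩
  have hχ : ContDiff ℝ ∞ χ := χ.contDiff
  obtain ⟨M, hM⟩ := (χ.hasCompactSupport.fderiv (𝕜 := ℝ)).exists_bound_of_continuous
    (hχ.continuous_fderiv (by simp))
  refine ⟨M, fun x₀ r hr => ⟨fun x => χ (r⁻¹ • (x - x₀)), ?_, fun x => χ.nonneg,
    fun x => χ.le_one, fun x hx => ?_, ?_, fun x => ?_⟩⟩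
  · exact hχ.comp ((contDiff_id.sub contDiff_const).const_smul _)
  · apply χ.one_of_mem_closedBall
    rw [mem_closedBall_zero_iff, norm_smul, norm_inv, Real.norm_of_nonneg hr.le,
      inv_mul_le_iff₀ hr, ← dist_eq_norm]
    rw [mem_ball] at hx
    change _ ≤ r * (1 / 4)
    linarith
  · refine closure_minimal (fun x hx => ?_) isClosed_closedBall
    have h1 : r⁻¹ • (x - x₀) ∈ Function.support χ := hx
    rw [χ.support_eq, mem_ball_zero_iff, norm_smul, norm_inv, Real.norm_of_nonneg hr.le,
      inv_mul_lt_iff₀ hr, ← dist_eq_norm] at h1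
    change _ < r * (1 / 2) at h1
    rw [mem_closedBall]
    linarith
  · have h1 : HasFDerivAt (fun y : R3 => r⁻¹ • (y - x₀)) (r⁻¹ • ContinuousLinearMap.id ℝ R3) x :=
      ((hasFDerivAt_id x).sub_const x₀).const_smul r⁻¹
    have h2 := (hχ.differentiable (by simp) (r⁻¹ • (x - x₀))).hasFDerivAt
    have h3 : fderiv ℝ (fun x => χ (r⁻¹ • (x - x₀))) x = _ :=
      (HasFDerivAt.comp (f := fun y : R3 => r⁻¹ • (y - x₀)) x h2 h1).fderiv
    rw [h3, ContinuousLinearMap.comp_smul, norm_smul, ContinuousLinearMap.comp_id, norm_inv,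
      Real.norm_of_nonneg hr.le, div_eq_inv_mul]
    gcongr
    exact hM _

variable {Ω : Set R3} {u : R3 → ℝ} {G : R3 → R3} {x₀ : R3} {r : ℝ}

/-- Fatou carries the symmetric Poincaré inequality from V_n to v. Keeping only those y with v y = 0
bounds the double integral below by ∫ v² times the measure of the zero set, which is at least half
of s. -/
lemma lintegral_sq_le_of_ae_tendsto {s : Set R3} (hs : Convex ℝ s) (hsm : MeasurableSet s)
    (hs0 : volume s ≠ 0) (hsf : volume s ≠ ⊤) {d : ℝ} (hd : ∀ x ∈ s, ∀ y ∈ s, dist x y ≤ d)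
    {V : ℕ → R3 → ℝ} (hV : ∀ n, ContDiff ℝ 1 (V n)) {v : R3 → ℝ}
    (hlim : ∀ᵐ x ∂volume.restrict s, Tendsto (V · x) atTop (𝓝 (v x))) {A : ℝ≥0∞}
    (hA : ∀ n, ∫⁻ x in s, ENNReal.ofReal (‖fderiv ℝ (V n) x‖ ^ 2) ≤ A)
    (hvan : volume s ≤ 2 * volume.restrict s {x | v x = 0}) :
    ∫⁻ x in s, ENNReal.ofReal (v x ^ 2) ≤ 16 * ENNReal.ofReal (d ^ 2) * A := by
  set μ := volume.restrict s with hμ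
  have hvm : AEMeasurable v μ :=
    aemeasurable_of_tendsto_metrizable_ae' (fun n => (hV n).continuous.aemeasurable) hlim
  have hstep : ∫⁻ x, ∫⁻ y, ENNReal.ofReal ((v x - v y) ^ 2) ∂μ ∂μ ≤
      ENNReal.ofReal (d ^ 2) * (8 * volume s * A) := by
    have hVc : ∀ n, Continuous fun p : R3 × R3 => ENNReal.ofReal ((V n p.1 - V n p.2) ^ 2) := by
      intro n
      have := (hV n).continuous
      exact ENNReal.continuous_ofReal.comp (by fun_prop)
    have hlim2 : ∀ᵐ x ∂μ, ∀ᵐ y ∂μ, Tendsto (fun n => ENNReal.ofReal ((V n x - V n y) ^ 2)) atTop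
        (𝓝 (ENNReal.ofReal ((v x - v y) ^ 2))) := by
      filter_upwards [hlim] with x hx
      filter_upwards [hlim] with y hy
      exact (ENNReal.continuous_ofReal.tendsto _).comp ((hx.sub hy).pow 2)
    calc ∫⁻ x, ∫⁻ y, ENNReal.ofReal ((v x - v y) ^ 2) ∂μ ∂μ
        = ∫⁻ x, ∫⁻ y, liminf (fun n => ENNReal.ofReal ((V n x - V n y) ^ 2)) atTop ∂μ ∂μ := by
          refine lintegral_congr_ae ?_
          filter_upwards [hlim2] with x hx
          refine lintegral_congr_ae ?_
          filter_upwards [hx] with y hy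
          exact hy.liminf_eq.symm
      _ ≤ ∫⁻ x, liminf (fun n => ∫⁻ y, ENNReal.ofReal ((V n x - V n y) ^ 2) ∂μ) atTop ∂μ :=
          lintegral_mono fun x => lintegral_liminf_le fun n =>
            ((hVc n).comp (Continuous.prodMk_right x)).measurable
      _ ≤ liminf (fun n => ∫⁻ x, ∫⁻ y, ENNReal.ofReal ((V n x - V n y) ^ 2) ∂μ ∂μ) atTop :=
          lintegral_liminf_le fun n => (hVc n).measurable.lintegral_prod_right'
      _ ≤ _ := by
          refine liminf_le_of_frequently_le' (Frequently.of_forall fun n => ?_)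
          refine (lintegral_lintegral_sub_sq_le hs hsm hd (hV n)).trans ?_
          gcongr
          exact hA n
  set Z := μ {x | v x = 0} with hZ
  have hlow : (∫⁻ x, ENNReal.ofReal (v x ^ 2) ∂μ) * Z ≤
      ∫⁻ x, ∫⁻ y, ENNReal.ofReal ((v x - v y) ^ 2) ∂μ ∂μ := by
    rw [← lintegral_mul_const'' _ (by fun_prop)]
    refine lintegral_mono fun x => ?_
    -- Markov in y at height v(x)², a value the integrand attains wherever v y = 0.
    refine le_trans ?_ (mul_meas_ge_le_lintegral₀ (by fun_prop) (ENNReal.ofReal (v x ^ 2)))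
    refine mul_le_mul' le_rfl (measure_mono fun y (hy : v y = 0) => ?_)
    simp [hy]
  have h2 : volume s * ∫⁻ x, ENNReal.ofReal (v x ^ 2) ∂μ ≤
      volume s * (16 * ENNReal.ofReal (d ^ 2) * A) :=
    calc _ ≤ 2 * Z * ∫⁻ x, ENNReal.ofReal (v x ^ 2) ∂μ := by gcongr
      _ = 2 * ((∫⁻ x, ENNReal.ofReal (v x ^ 2) ∂μ) * Z) := by ring
      _ ≤ 2 * (ENNReal.ofReal (d ^ 2) * (8 * volume s * A)) := mul_le_mul' le_rfl (hlow.trans hstep)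
      _ = _ := by ring
  exact (ENNReal.mul_le_mul_iff_right hs0 hsf).1 h2

end Truncation

/-! ### Estimates on superlevel sets -/

section Decay

variable {Ω : Set R3} {u : R3 → ℝ} {G : R3 → R3} {x₀ : R3} {r : ℝ}

/-- A level `m` above which `u` spends at most half of the ball of radius `r / 2`. -/
def IsHalfLevel (u : R3 → ℝ) (x₀ : R3) (r m : ℝ) : Prop :=
  volume (closedBall x₀ (r / 2)) ≤ 2 * volume.restrict (closedBall x₀ (r / 2)) {x | u x ≤ m}

lemma lintegral_fderiv_smoothStep_sq_le {L : ℝ} (hL : ∀ s, ‖deriv smoothTransition s‖ ≤ L) {m K : ℝ} (hK : 0 < K) {U : R3 → ℝ}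
    (hU : Differentiable ℝ U) {s : Set R3} {A : ℝ}
    (hA : ∫⁻ x in s, ENNReal.ofReal (‖fderiv ℝ U x‖ ^ 2) ≤ ENNReal.ofReal A) :
    ∫⁻ x in s, ENNReal.ofReal (‖fderiv ℝ (fun y => smoothStep m K (U y)) x‖ ^ 2) ≤
      ENNReal.ofReal ((L / K) ^ 2 * A) := by
  rw [ENNReal.ofReal_mul (sq_nonneg _)]
  refine le_trans ?_ (mul_le_mul' le_rfl hA)
  rw [← lintegral_const_mul' _ _ ENNReal.ofReal_ne_top]
  refine lintegral_mono fun x => ?_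
  rw [← ENNReal.ofReal_mul (sq_nonneg _), ← mul_pow]
  exact ENNReal.ofReal_le_ofReal
    (pow_le_pow_left₀ (norm_nonneg _) (norm_fderiv_smoothStep_comp_le hL hK (hU x)) 2)

/-- The truncation vanishes where u ≤ m, so the half-level condition supplies the zero set needed
for Poincaré. -/
lemma integral_smoothStep_sq_le {L : ℝ} (hL : ∀ s, ‖deriv smoothTransition s‖ ≤ L) {m K : ℝ} (hK : 0 < K) (hr : 0 < r)
    {U : ℕ → R3 → ℝ} (hU : ∀ n, ContDiff ℝ ∞ (U n))
    (hlim : ∀ᵐ x ∂volume.restrict (closedBall x₀ (r / 2)), Tendsto (U · x) atTop (𝓝 (u x)))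
    {A : ℝ} (hA0 : 0 ≤ A) (hA : ∀ n, ∫⁻ x in closedBall x₀ (r / 2),
      ENNReal.ofReal (‖fderiv ℝ (U n) x‖ ^ 2) ≤ ENNReal.ofReal A)
    (hm : IsHalfLevel u x₀ r m) :
    ∫ x in closedBall x₀ (r / 2), smoothStep m K (u x) ^ 2 ≤ 16 * r ^ 2 * (L / K) ^ 2 * A := by
  have h1 := lintegral_sq_le_of_ae_tendsto (convex_closedBall x₀ (r / 2)) measurableSet_closedBall
    (measure_closedBall_pos volume x₀ (by positivity)).ne' measure_closedBall_lt_top.ne (d := r)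
    (fun x hx y hy => by
      have := dist_triangle_right x y x₀
      rw [mem_closedBall] at hx hy; linarith)
    (V := fun n x => smoothStep m K (U n x))
    (fun n => ((contDiff_smoothStep m K).comp (hU n)).of_le (by simp))
    (v := fun x => smoothStep m K (u x))
    (by filter_upwards [hlim] with x hx using ((continuous_smoothStep m K).tendsto _).comp hx)
    (fun n => lintegral_fderiv_smoothStep_sq_le hL hK ((hU n).differentiable (by simp)) (hA n))
    (hm.trans (mul_le_mul' le_rfl (measure_mono fun x (hx : u x ≤ m) => smoothStep_eq_zero hK hx)))
  have hum : AEMeasurable u (volume.restrict (closedBall x₀ (r / 2))) :=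
    aemeasurable_of_tendsto_metrizable_ae' (fun n => (hU n).continuous.aemeasurable) hlim
  have hTm : AEMeasurable (fun x => smoothStep m K (u x))
      (volume.restrict (closedBall x₀ (r / 2))) :=
    (continuous_smoothStep m K).measurable.comp_aemeasurable hum
  rw [integral_eq_lintegral_of_nonneg_ae (ae_of_all _ fun x => sq_nonneg _)
    (hTm.pow_const 2).aestronglyMeasurable]
  refine ENNReal.toReal_le_of_le_ofReal (by positivity) (h1.trans_eq ?_)
  rw [← ENNReal.ofReal_ofNat, ← ENNReal.ofReal_mul (by norm_num),
    ← ENNReal.ofReal_mul (by positivity)]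
  congr 1; ring

/-- Testing the equation with a truncation of a smooth function. -/
lemma IsW12.integral_exp_mul_smoothStep_le (h : IsW12 Ω u G) (hΩ : IsOpen Ω)
    (hL : IsWeakLiouville Ω u) (hr : 0 < r) (hball : ball x₀ r ⊆ Ω) {L : ℝ}
    (hL0 : 0 ≤ L) (hLd : ∀ s, ‖deriv smoothTransition s‖ ≤ L) {m K : ℝ} (hK : 0 < K)
    {φ : R3 → ℝ} (hφ : ContDiff ℝ ∞ φ) (hφ0 : ∀ x, 0 ≤ φ x) (hφ1 : ∀ x, φ x ≤ 1)
    (hφs : tsupport φ ⊆ closedBall x₀ (r / 2)) {M : ℝ} (hM : ∀ x, ‖fderiv ℝ φ x‖ ≤ M)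
    {U : R3 → ℝ} (hU : ContDiff ℝ ∞ U)
    (hA : ∫⁻ x in closedBall x₀ (r / 2), ENNReal.ofReal (‖fderiv ℝ U x‖ ^ 2) ≤
      ENNReal.ofReal (∫ x in ball x₀ r, ‖G x‖ ^ 2)) :
    ∫ x in closedBall x₀ (r / 2), exp (u x) * (smoothStep m K (U x) * φ x) ≤
      (L + 1 / 2) / K * (∫ x in ball x₀ r, ‖G x‖ ^ 2) +
        K * M ^ 2 / 2 * ∫ x in closedBall x₀ (r / 2), smoothStep m K (U x) ^ 2 := by
  set D := closedBall x₀ (r / 2) with hD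
  set A := ∫ x in ball x₀ r, ‖G x‖ ^ 2 with hAdef
  have hDb : D ⊆ ball x₀ r := closedBall_subset_ball (by linarith)
  have hDΩ : D ⊆ Ω := hDb.trans hball
  have hA0 : 0 ≤ A := integral_nonneg fun x => sq_nonneg _
  set V : R3 → ℝ := fun x => smoothStep m K (U x) with hV
  have hVc : ContDiff ℝ ∞ V := (contDiff_smoothStep m K).comp hU
  set ψ : R3 → ℝ := fun x => V x * φ x with hψ
  have hψs : tsupport ψ ⊆ D := (tsupport_mul_subset_right).trans hφs
  have hψt : IsTestFun Ω ψ := ⟨hVc.mul hφ,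
    (isCompact_closedBall x₀ (r / 2)).of_isClosed_subset (isClosed_tsupport _) hψs, hψs.trans hDΩ⟩
  have hψ0 : ∀ x, x ∉ D → ψ x = 0 := fun x hx =>
    by_contra fun h0 => hx (hψs (subset_tsupport _ h0))
  have hψd0 : ∀ x, x ∉ D → fderiv ℝ ψ x = 0 := fun x hx =>
    by_contra fun h0 => hx (hψs (support_fderiv_subset ℝ h0))
  have heq : ∫ x in D, exp (u x) * ψ x = ∫ x in D, fderiv ℝ ψ x (G x) := by
    rw [← setIntegral_eq_of_subset_of_forall_sdiff_eq_zero hΩ.measurableSet hDΩ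
        fun x hx => by rw [hψ0 x hx.2, mul_zero],
      ← setIntegral_eq_of_subset_of_forall_sdiff_eq_zero hΩ.measurableSet hDΩ
        fun x hx => by rw [hψd0 x hx.2]; rfl]
    exact (h.integral_fderiv_apply_grad hL hψt).symm
  have hGb : IntegrableOn (fun x => ‖G x‖ ^ 2) (ball x₀ r) :=
    (h.memLp_grad.mono_measure (Measure.restrict_mono hball le_rfl)).integrable_norm_pow two_ne_zero
  have hGD : IntegrableOn (fun x => ‖G x‖ ^ 2) D := hGb.mono_set hDb
  have hUc : Continuous (fderiv ℝ U) := hU.continuous_fderiv (by simp)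
  have hVcc : Continuous V := hVc.continuous
  have hUi : IntegrableOn (fun x => ‖fderiv ℝ U x‖ ^ 2) D :=
    ContinuousOn.integrableOn_compact (isCompact_closedBall _ _)
      (Continuous.continuousOn (by fun_prop))
  have hVi : IntegrableOn (fun x => V x ^ 2) D :=
    ContinuousOn.integrableOn_compact (isCompact_closedBall _ _)
      (Continuous.continuousOn (by fun_prop))
  have hGA : ∫ x in D, ‖G x‖ ^ 2 ≤ A :=
    setIntegral_mono_set hGb (ae_of_all _ fun x => sq_nonneg _) hDb.eventuallyLE
  have hUA : ∫ x in D, ‖fderiv ℝ U x‖ ^ 2 ≤ A := by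
    rwa [← ENNReal.ofReal_le_ofReal_iff hA0,
      ofReal_integral_eq_lintegral_ofReal hUi (ae_of_all _ fun x => sq_nonneg _)]
  -- Young's inequality: the product |∇U||G| is split evenly, while M V |G| is split with weight K.
  -- As ∫ V² will be O(K⁻²), every term ends up O(1/K).
  have hbound : ∀ x, ‖fderiv ℝ ψ x (G x)‖ ≤
      L / (2 * K) * ‖fderiv ℝ U x‖ ^ 2 + (L + 1) / (2 * K) * ‖G x‖ ^ 2
        + K * M ^ 2 / 2 * V x ^ 2 := by
    intro x
    have hd : fderiv ℝ ψ x = V x • fderiv ℝ φ x + φ x • fderiv ℝ V x :=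
      fderiv_mul (hVc.differentiable (by simp) x) (hφ.differentiable (by simp) x)
    have hV0 : 0 ≤ V x := smoothStep_nonneg _ _ _
    have hn : ‖fderiv ℝ ψ x‖ ≤ V x * M + L / K * ‖fderiv ℝ U x‖ := by
      rw [hd]
      refine (norm_add_le _ _).trans (add_le_add ?_ ?_)
      · rw [norm_smul, Real.norm_of_nonneg hV0]
        exact mul_le_mul_of_nonneg_left (hM x) hV0
      · rw [norm_smul, Real.norm_of_nonneg (hφ0 x)]
        exact (mul_le_of_le_one_left (norm_nonneg _) (hφ1 x)).trans
          (norm_fderiv_smoothStep_comp_le hLd hK (hU.differentiable (by simp) x))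
    have h1 : ‖fderiv ℝ ψ x (G x)‖ ≤ (V x * M + L / K * ‖fderiv ℝ U x‖) * ‖G x‖ :=
      (ContinuousLinearMap.le_opNorm _ _).trans (mul_le_mul_of_nonneg_right hn (norm_nonneg _))
    refine h1.trans ?_
    have h2 : 0 ≤ L / (2 * K) * (‖fderiv ℝ U x‖ - ‖G x‖) ^ 2 := by positivity
    have h3 : 0 ≤ 1 / (2 * K) * (K * M * V x - ‖G x‖) ^ 2 := by positivity
    have h4 : L / (2 * K) * ‖fderiv ℝ U x‖ ^ 2 + (L + 1) / (2 * K) * ‖G x‖ ^ 2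
        + K * M ^ 2 / 2 * V x ^ 2 - (V x * M + L / K * ‖fderiv ℝ U x‖) * ‖G x‖ =
        L / (2 * K) * (‖fderiv ℝ U x‖ - ‖G x‖) ^ 2 +
          1 / (2 * K) * (K * M * V x - ‖G x‖) ^ 2 := by
      field_simp; ring
    linarith
  have i1 := hUi.const_mul (L / (2 * K))
  have i2 := hGD.const_mul ((L + 1) / (2 * K))
  have i3 := hVi.const_mul (K * M ^ 2 / 2)
  rw [heq]
  calc ∫ x in D, fderiv ℝ ψ x (G x)
      ≤ ∫ x in D, (L / (2 * K) * ‖fderiv ℝ U x‖ ^ 2 + (L + 1) / (2 * K) * ‖G x‖ ^ 2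
        + K * M ^ 2 / 2 * V x ^ 2) := (le_abs_self _).trans
          (norm_integral_le_of_norm_le ((i1.add i2).add i3) (ae_of_all _ hbound))
    _ = L / (2 * K) * (∫ x in D, ‖fderiv ℝ U x‖ ^ 2) + (L + 1) / (2 * K) * (∫ x in D, ‖G x‖ ^ 2)
        + K * M ^ 2 / 2 * ∫ x in D, V x ^ 2 := by
        rw [← integral_const_mul, ← integral_const_mul, ← integral_const_mul,
          ← integral_add i1 i2]
        exact integral_add (i1.add i2) i3
    _ ≤ L / (2 * K) * A + (L + 1) / (2 * K) * A + K * M ^ 2 / 2 * ∫ x in D, V x ^ 2 := by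
        gcongr
    _ = _ := by field_simp; ring

/-- Bounds for the measure of superlevel sets and for the mass of `e^u` on them. -/
lemma exists_truncation_bounds : ∃ C : ℝ, 0 < C ∧
    ∀ (Ω : Set R3), IsOpen Ω → ∀ (u : R3 → ℝ) (G : R3 → R3), IsW12 Ω u G →
      IntegrableOn (fun x => exp (u x)) Ω → IsWeakLiouville Ω u →
      ∀ (x₀ : R3) (r : ℝ), 0 < r → ball x₀ r ⊆ Ω → ∀ m K : ℝ, 0 < K → IsHalfLevel u x₀ r m →
        (∫ x in closedBall x₀ (r / 2), smoothStep m K (u x) ^ 2 ≤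
          C * r ^ 2 / K ^ 2 * ∫ x in ball x₀ r, ‖G x‖ ^ 2) ∧
        ∫ x in ball x₀ (r / 4), exp (u x) * smoothStep m K (u x) ≤
          C / K * ∫ x in ball x₀ r, ‖G x‖ ^ 2 := by
  obtain ⟨L, hL0, hLd⟩ := exists_bound_deriv_smoothTransition
  obtain ⟨M, hM⟩ := exists_cutoff
  -- The first summand serves the measure bound, the other two the mass bound; 8M²L² comes from
  -- inserting the former into the latter.
  refine ⟨16 * L ^ 2 + (L + 1 / 2) + 8 * M ^ 2 * L ^ 2, by positivity, ?_⟩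
  intro Ω hΩ u G h hexp hL x₀ r hr hball m K hK hm
  obtain ⟨U, hU, hlim, hA⟩ := h.exists_smooth_approx hΩ hr hball
  obtain ⟨φ, hφ, hφ0, hφ1, hφone, hφs, hφM⟩ := hM x₀ r hr
  set D := closedBall x₀ (r / 2) with hD
  set A := ∫ x in ball x₀ r, ‖G x‖ ^ 2 with hAdef
  have hA0 : 0 ≤ A := integral_nonneg fun x => sq_nonneg _
  have hDΩ : D ⊆ Ω := (closedBall_subset_ball (by linarith)).trans hball
  have hqD : ball x₀ (r / 4) ⊆ D := (ball_subset_ball (by linarith)).trans ball_subset_closedBall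
  have hexpD : IntegrableOn (fun x => exp (u x)) D := hexp.mono_set hDΩ
  have hsq := integral_smoothStep_sq_le (m := m) hLd hK hr hU hlim hA0 hA hm
  have hT := continuous_smoothStep m K
  have hn := fun n => h.integral_exp_mul_smoothStep_le hΩ hL hr hball hL0 hLd (m := m) hK hφ hφ0 hφ1
    hφs hφM (hU n) (hA n)
  have hlimT : ∀ᵐ x ∂volume.restrict D,
      Tendsto (fun n => smoothStep m K (U n x)) atTop (𝓝 (smoothStep m K (u x))) := by
    filter_upwards [hlim] with x hx using (hT.tendsto _).comp hx
  have hum : AEMeasurable u (volume.restrict D) :=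
    aemeasurable_of_tendsto_metrizable_ae' (fun n => (hU n).continuous.aemeasurable) hlim
  have hTum : AEStronglyMeasurable (fun x => smoothStep m K (u x)) (volume.restrict D) :=
    (hT.measurable.comp_aemeasurable hum).aestronglyMeasurable
  have hT1 : ∀ s, ‖smoothStep m K s‖ ≤ 1 := fun s => by
    rw [Real.norm_of_nonneg (smoothStep_nonneg _ _ _)]; exact smoothStep_le_one _ _ _
  have hprod : ∀ s x, ‖smoothStep m K s * φ x‖ ≤ 1 := fun s x => by
    rw [norm_mul, Real.norm_of_nonneg (hφ0 x)]
    exact mul_le_one₀ (hT1 s) (hφ0 x) (hφ1 x)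
  have hLlim : Tendsto (fun n => ∫ x in D, exp (u x) * (smoothStep m K (U n x) * φ x)) atTop
      (𝓝 (∫ x in D, exp (u x) * (smoothStep m K (u x) * φ x))) := by
    refine tendsto_integral_of_dominated_convergence (fun x => exp (u x)) (fun n => ?_) hexpD
      (fun n => ae_of_all _ fun x => ?_) ?_
    · exact hexpD.aestronglyMeasurable.mul
        ((hT.comp (hU n).continuous).mul hφ.continuous).aestronglyMeasurable
    · rw [norm_mul, Real.norm_of_nonneg (exp_pos _).le]
      exact mul_le_of_le_one_right (exp_pos _).le (hprod _ _)
    · filter_upwards [hlimT] with x hx using (hx.mul_const _).const_mul _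
  have hRlim : Tendsto (fun n => ∫ x in D, smoothStep m K (U n x) ^ 2) atTop
      (𝓝 (∫ x in D, smoothStep m K (u x) ^ 2)) := by
    refine tendsto_integral_of_dominated_convergence (fun _ => 1) (fun n => ?_)
      (integrableOn_const measure_closedBall_lt_top.ne) (fun n => ae_of_all _ fun x => ?_) ?_
    · exact ((hT.comp (hU n).continuous).pow 2).aestronglyMeasurable
    · rw [norm_pow]; exact pow_le_one₀ (norm_nonneg _) (hT1 _)
    · filter_upwards [hlimT] with x hx using hx.pow 2
  -- Only the truncations of U_n remain in the tested inequality, so dominated convergence on both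
  -- sides suffices.
  have hlimit := le_of_tendsto_of_tendsto' hLlim (hRlim.const_mul _ |>.const_add _) hn
  refine ⟨hsq.trans ?_, ?_⟩
  · calc 16 * r ^ 2 * (L / K) ^ 2 * A = (16 * L ^ 2) * r ^ 2 / K ^ 2 * A := by ring
      _ ≤ _ := by
        gcongr
        have : 0 ≤ 8 * M ^ 2 * L ^ 2 := by positivity
        linarith
  · calc ∫ x in ball x₀ (r / 4), exp (u x) * smoothStep m K (u x)
        = ∫ x in ball x₀ (r / 4), exp (u x) * (smoothStep m K (u x) * φ x) :=
          setIntegral_congr_fun measurableSet_ball fun x hx => by simp [hφone x hx]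
      _ ≤ ∫ x in D, exp (u x) * (smoothStep m K (u x) * φ x) := by
          refine setIntegral_mono_set ?_ (ae_of_all _ fun x => ?_) hqD.eventuallyLE
          · refine hexpD.mul_bdd (c := 1) (hTum.mul hφ.continuous.aestronglyMeasurable)
              (ae_of_all _ fun x => hprod _ _)
          · exact mul_nonneg (exp_pos _).le (mul_nonneg (smoothStep_nonneg _ _ _) (hφ0 x))
      _ ≤ _ := hlimit
      _ ≤ (L + 1 / 2) / K * A + K * (M / r) ^ 2 / 2 * (16 * r ^ 2 * (L / K) ^ 2 * A) := by
          gcongr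
      _ = (L + 1 / 2 + 8 * M ^ 2 * L ^ 2) / K * A := by field_simp; ring
      _ ≤ _ := by
        refine mul_le_mul_of_nonneg_right (div_le_div_of_nonneg_right ?_ hK.le) hA0
        have : 0 ≤ 16 * L ^ 2 := by positivity
        linarith

end Decay

/-! ### Choice of the level and the decay estimate -/

section Main

/-- A ball is connected, so leaving Ω would force it to meet the frontier, which lies farther than r
from its centre. -/
lemma ball_subset_of_lt_infEDist_frontier {Ω : Set R3} (hΩ : IsOpen Ω) {x₀ : R3} (hx : x₀ ∈ Ω)
    {r : ℝ} (hr : 0 < r) (h : ENNReal.ofReal r < infEDist x₀ (frontier Ω)) : ball x₀ r ⊆ Ω := by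
  refine (convex_ball x₀ r).isPreconnected.subset_of_closure_inter_subset hΩ
    ⟨x₀, mem_ball_self hr, hx⟩ fun y hy => ?_
  by_contra hyΩ
  have hyf : y ∈ frontier Ω := by rw [hΩ.frontier_eq]; exact ⟨hy.1, hyΩ⟩
  have h1 : ENNReal.ofReal r < edist x₀ y := h.trans_le (infEDist_le_edist_of_mem hyf)
  rw [edist_dist, ENNReal.ofReal_lt_ofReal_iff_of_nonneg hr.le, dist_comm] at h1
  exact lt_asymm h1 (mem_ball.1 hy.2)

lemma measureReal_ball_eq (x : R3) {s : ℝ} (hs : 0 ≤ s) :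
    volume.real (ball x s) = s ^ 3 * volume.real (ball (0 : R3) 1) := by
  rw [Measure.real, Measure.addHaar_ball _ _ hs, ENNReal.toReal_mul,
    ENNReal.toReal_ofReal (by positivity)]
  simp [Measure.real]

/-- Chebyshev for e^u: the set where u ≥ m fills at most half of the ball. -/
lemma isHalfLevel_of_integral_exp_le {u : R3 → ℝ} {x₀ : R3} {r m : ℝ}
    (hexp : IntegrableOn (fun x => exp (u x)) (closedBall x₀ (r / 2)))
    (h : 2 * ∫ x in closedBall x₀ (r / 2), exp (u x) ≤
      exp m * volume.real (closedBall x₀ (r / 2))) : IsHalfLevel u x₀ r m := by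
  set D := closedBall x₀ (r / 2) with hD
  set μ := volume.restrict D with hμ
  have : IsFiniteMeasure μ := ⟨by rw [hμ, Measure.restrict_apply_univ]
                                  exact measure_closedBall_lt_top⟩
  have hmark : exp m * μ.real {x | exp m ≤ exp (u x)} ≤ ∫ x in D, exp (u x) :=
    mul_meas_ge_le_integral_of_nonneg (ae_of_all _ fun x => (exp_pos _).le) hexp _
  have hDr : volume.real D = μ.real univ := by rw [Measure.real, Measure.real, hμ]; simp
  have hcover : μ.real univ ≤ μ.real {x | u x ≤ m} + μ.real {x | exp m ≤ exp (u x)} := by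
    refine (measureReal_mono fun x _ => ?_).trans (measureReal_union_le _ _)
    rcases le_total (u x) m with hx | hx
    · exact Or.inl hx
    · exact Or.inr (exp_le_exp.2 hx)
  have hhalf : 2 * μ.real {x | exp m ≤ exp (u x)} ≤ volume.real D := by
    refine le_of_mul_le_mul_left ?_ (exp_pos m)
    linarith
  have hfin : volume.real D ≤ 2 * μ.real {x | u x ≤ m} := by linarith
  rw [IsHalfLevel, ← ENNReal.toReal_le_toReal measure_closedBall_lt_top.ne
    (ENNReal.mul_ne_top (by simp) (measure_ne_top μ _)), ENNReal.toReal_mul]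
  exact hfin

lemma exp_le_add_smoothStep {m K s : ℝ} (hK : 0 < K) :
    exp s ≤ exp (m + 1) + exp (m + K) * smoothStep m 1 s ^ 2 + exp s * smoothStep m K s := by
  have h1 : 0 ≤ exp (m + K) * smoothStep m 1 s ^ 2 := by positivity
  have h2 : 0 ≤ exp s * smoothStep m K s := mul_nonneg (exp_pos _).le (smoothStep_nonneg _ _ _)
  have h3 := exp_pos (m + 1)
  have h4 := exp_pos (m + K)
  rcases le_total s (m + 1) with h | h
  · have := exp_le_exp.2 h
    linarith
  rcases le_total s (m + K) with h' | h'
  · have := exp_le_exp.2 h'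
    rw [smoothStep_eq_one one_pos h]
    linarith
  · rw [smoothStep_eq_one hK h']
    linarith

/-- Only the bounded part of e^u profits from the small radius s, through the volume s³; the other
two parts are enlarged to fixed balls. -/
lemma setIntegral_exp_le {u : R3 → ℝ} {x₀ : R3} {r s m K : ℝ} (hr : 0 < r) (hs : 0 ≤ s)
    (hsr : s ≤ r / 4) (hK : 0 < K)
    (hum : AEMeasurable u (volume.restrict (closedBall x₀ (r / 2))))
    (hexp : IntegrableOn (fun x => exp (u x)) (closedBall x₀ (r / 2))) :
    ∫ x in ball x₀ s, exp (u x) ≤ exp (m + 1) * (s ^ 3 * volume.real (ball (0 : R3) 1)) +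
      exp (m + K) * (∫ x in closedBall x₀ (r / 2), smoothStep m 1 (u x) ^ 2) +
      ∫ x in ball x₀ (r / 4), exp (u x) * smoothStep m K (u x) := by
  set D := closedBall x₀ (r / 2) with hD
  have hbD : ball x₀ (r / 4) ⊆ D := (ball_subset_ball (by linarith)).trans ball_subset_closedBall
  have hsb : ball x₀ s ⊆ ball x₀ (r / 4) := ball_subset_ball hsr
  have hTm : ∀ K, AEStronglyMeasurable (fun x => smoothStep m K (u x)) (volume.restrict D) :=
    fun K => ((continuous_smoothStep m K).measurable.comp_aemeasurable hum).aestronglyMeasurable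
  have hT1 : ∀ K s, ‖smoothStep m K s‖ ≤ 1 := fun K s => by
    rw [Real.norm_of_nonneg (smoothStep_nonneg _ _ _)]; exact smoothStep_le_one _ _ _
  have i2 : IntegrableOn (fun x => smoothStep m 1 (u x) ^ 2) D := by
    refine Integrable.mono' (integrableOn_const (C := (1 : ℝ)) measure_closedBall_lt_top.ne)
      ((hTm 1).pow 2) (ae_of_all _ fun x => ?_)
    rw [norm_pow]; exact pow_le_one₀ (norm_nonneg _) (hT1 _ _)
  have i3 : IntegrableOn (fun x => exp (u x) * smoothStep m K (u x)) D :=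
    hexp.mul_bdd (c := 1) (hTm K) (ae_of_all _ fun x => hT1 _ _)
  have j1 : IntegrableOn (fun _ => exp (m + 1)) (ball x₀ s) :=
    integrableOn_const measure_ball_lt_top.ne
  have j2 := (i2.mono_set (hsb.trans hbD)).const_mul (exp (m + K))
  have j3 := i3.mono_set (hsb.trans hbD)
  have j4 : IntegrableOn (fun x => exp (m + 1) + exp (m + K) * smoothStep m 1 (u x) ^ 2
      + exp (u x) * smoothStep m K (u x)) (ball x₀ s) := (j1.add j2).add j3
  calc ∫ x in ball x₀ s, exp (u x)
      ≤ ∫ x in ball x₀ s, (exp (m + 1) + exp (m + K) * smoothStep m 1 (u x) ^ 2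
          + exp (u x) * smoothStep m K (u x)) :=
        integral_mono (hexp.mono_set (hsb.trans hbD)) j4
          fun x => exp_le_add_smoothStep hK
    _ = exp (m + 1) * (s ^ 3 * volume.real (ball (0 : R3) 1)) +
        exp (m + K) * (∫ x in ball x₀ s, smoothStep m 1 (u x) ^ 2) +
        ∫ x in ball x₀ s, exp (u x) * smoothStep m K (u x) := by
        rw [← integral_const_mul, ← measureReal_ball_eq x₀ hs, mul_comm (exp (m + 1)),
          ← smul_eq_mul (volume.real (ball x₀ s)), ← setIntegral_const, ← integral_add j1 j2]
        exact integral_add (j1.add j2) j3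
    _ ≤ _ := by
        gcongr ?_ + _ * ?_ + ?_
        · exact le_rfl
        · exact setIntegral_mono_set i2 (ae_of_all _ fun x => sq_nonneg _)
            (hsb.trans hbD).eventuallyLE
        · exact setIntegral_mono_set (i3.mono_set hbD)
            (ae_of_all _ fun x => mul_nonneg (exp_pos _).le (smoothStep_nonneg _ _ _))
            hsb.eventuallyLE

/-- A quantitative form of the decay estimate with a free truncation parameter `K`. -/
lemma exists_decay_bound : ∃ C : ℝ, 0 < C ∧
    ∀ (Ω : Set R3), IsOpen Ω → ∀ (u : R3 → ℝ) (G : R3 → R3), IsW12 Ω u G →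
      IntegrableOn (fun x => exp (u x)) Ω → IsWeakLiouville Ω u →
      ∀ (x₀ : R3) (r : ℝ), 0 < r → ball x₀ r ⊆ Ω → 0 ≤ energy r x₀ u G ∧
        ∀ K ρ : ℝ, 0 < K → 0 < ρ → ρ ≤ 1 / 4 →
        1 / (ρ * r) * ∫ x in ball x₀ (ρ * r), exp (u x) ≤
          (16 * exp 1 * ρ ^ 2 + C * exp K * energy r x₀ u G / ρ + C / (K * ρ)) *
            energy r x₀ u G := by
  obtain ⟨C, hC, hbd⟩ := exists_truncation_bounds
  set β := volume.real (ball (0 : R3) 1) with hβ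
  have hβ0 : 0 < β := ENNReal.toReal_pos (measure_ball_pos volume 0 one_pos).ne'
    measure_ball_lt_top.ne
  refine ⟨max C (16 / β * C), lt_max_of_lt_left hC, ?_⟩
  intro Ω hΩ u G h hexp hL x₀ r hr hball
  set E := energy r x₀ u G with hE
  set A := ∫ x in ball x₀ r, ‖G x‖ ^ 2 with hA
  set B := ∫ x in ball x₀ r, exp (u x) with hB
  have hEdef : r * E = A + B := by
    rw [hE, energy, ← hA, ← hB]; field_simp
  have hexpb : IntegrableOn (fun x => exp (u x)) (ball x₀ r) := hexp.mono_set hball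
  have hA0 : 0 ≤ A := integral_nonneg fun x => sq_nonneg _
  -- Strict positivity makes E > 0, so that the logarithm defining m is meaningful.
  have hB0 : 0 < B := by
    rw [hB, setIntegral_pos_iff_support_of_nonneg_ae (ae_of_all _ fun x => (exp_pos _).le) hexpb]
    have : Function.support (fun x => exp (u x)) = univ := by
      ext x; simp [(exp_pos (u x)).ne']
    rw [this, univ_inter]
    exact measure_ball_pos volume x₀ hr
  have hE0 : 0 < E := by
    have : 0 < r * E := by linarith
    exact (mul_pos_iff_of_pos_left hr).1 this
  refine ⟨hE0.le, fun K ρ hK hρ hρ4 => ?_⟩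
  set D := closedBall x₀ (r / 2) with hD
  have hDb : D ⊆ ball x₀ r := closedBall_subset_ball (by linarith)
  have hexpD : IntegrableOn (fun x => exp (u x)) D := hexpb.mono_set hDb
  have hBD : ∫ x in D, exp (u x) ≤ B :=
    setIntegral_mono_set hexpb (ae_of_all _ fun x => (exp_pos _).le) hDb.eventuallyLE
  -- Chosen so that e^m times the volume of `D` equals 2rE, which dominates 2∫ e^u over `D`.
  set m := log (16 / β * E / r ^ 2) with hm
  have hem : exp m = 16 / β * E / r ^ 2 := exp_log (by positivity)
  have hvolD : volume.real D = (r / 2) ^ 3 * β := by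
    rw [hD, Measure.real, Measure.addHaar_closedBall_eq_addHaar_ball, ← Measure.real,
      measureReal_ball_eq _ (by positivity)]
  have hhalf : IsHalfLevel u x₀ r m := by
    refine isHalfLevel_of_integral_exp_le hexpD ?_
    rw [← hD, hvolD, hem]
    have : 16 / β * E / r ^ 2 * ((r / 2) ^ 3 * β) = 2 * (r * E) := by field_simp; norm_num
    rw [this]
    linarith
  -- The same level is used with two widths: 1 for the measure of the intermediate range, K for the
  -- mass of the top range.
  obtain ⟨h1, -⟩ := hbd Ω hΩ u G h hexp hL x₀ r hr hball m 1 one_pos hhalf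
  obtain ⟨-, h2⟩ := hbd Ω hΩ u G h hexp hL x₀ r hr hball m K hK hhalf
  have hum : AEMeasurable u (volume.restrict D) :=
    (h.memLp.1.mono_measure (Measure.restrict_mono (hDb.trans hball) le_rfl)).aemeasurable
  have hmain := setIntegral_exp_le (m := m) (s := ρ * r) hr (by positivity) (by nlinarith) hK
    hum hexpD
  have hAE : A ≤ r * E := by linarith
  have hM1 : 16 / β * C ≤ max C (16 / β * C) := le_max_right _ _
  have hM2 : C ≤ max C (16 / β * C) := le_max_left _ _
  have hfin : ∫ x in ball x₀ (ρ * r), exp (u x) ≤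
      16 / β * E / r ^ 2 * exp 1 * ((ρ * r) ^ 3 * β) +
        16 / β * E / r ^ 2 * exp K * (C * r ^ 2 / 1 ^ 2 * (r * E)) + C / K * (r * E) := by
    refine hmain.trans ?_
    rw [exp_add, exp_add, hem]
    gcongr ?_ + ?_ * ?_ + ?_
    · exact le_rfl
    · exact h1.trans (by gcongr)
    · exact h2.trans (by gcongr)
  calc 1 / (ρ * r) * ∫ x in ball x₀ (ρ * r), exp (u x)
      ≤ 1 / (ρ * r) * (16 / β * E / r ^ 2 * exp 1 * ((ρ * r) ^ 3 * β) +
        16 / β * E / r ^ 2 * exp K * (C * r ^ 2 / 1 ^ 2 * (r * E)) + C / K * (r * E)) := by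
        gcongr
    _ = (16 * exp 1 * ρ ^ 2 + 16 / β * C * exp K * E / ρ + C / (K * ρ)) * E := by
        field_simp
    _ ≤ _ := by gcongr

end Main

theorem theorem3 (α : ℝ) (hα0 : 0 < α) (hα1 : α < 1) :
    ∃ η : ℝ, 0 < η ∧ η < 1 ∧ ∃ ρ₁ ρ₂ : ℝ, 0 < ρ₁ ∧ ρ₁ < ρ₂ ∧ ρ₂ < 1 ∧
      ∀ (Ω : Set R3), IsOpen Ω →
      ∀ (u : R3 → ℝ) (G : R3 → R3), IsW12 Ω u G →
        IntegrableOn (fun x => Real.exp (u x)) Ω → IsWeakLiouville Ω u →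
      ∀ x₀ ∈ Ω, ∀ r : ℝ, 0 < r → ENNReal.ofReal r < Metric.infEDist x₀ (frontier Ω) →
        energy r x₀ u G ≤ η →
      ∀ ρ ∈ Set.Icc ρ₁ ρ₂,
        1 / (ρ * r) * ∫ x in Metric.ball x₀ (ρ * r), Real.exp (u x) ≤ α * energy r x₀ u G := by
  obtain ⟨C, hC, hbd⟩ := exists_decay_bound
  -- With ρ between α/32 and α/16, the values of K and b turn the last and the middle error terms
  -- into exactly α/3 at ρ = α/32 and energy b; the first is at most 3α²/16.
  set K : ℝ := 96 * C / α ^ 2 with hK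
  have hK0 : 0 < K := by positivity
  set b : ℝ := α ^ 2 / (96 * (C * exp K)) with hb
  have hb0 : 0 < b := by positivity
  refine ⟨min (1 / 2) b, by positivity, (min_le_left _ _).trans_lt (by norm_num), α / 32, α / 16,
    by positivity, by linarith, by linarith, ?_⟩
  intro Ω hΩ u G h hexp hL x₀ hx₀ r hr hdist hE ρ hρ
  obtain ⟨hE0, hdecay⟩ := hbd Ω hΩ u G h hexp hL x₀ r hr
    (ball_subset_of_lt_infEDist_frontier hΩ hx₀ hr hdist)
  have hρ0 : 0 < ρ := lt_of_lt_of_le (by positivity) hρ.1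
  refine (hdecay K ρ hK0 hρ0 (by linarith [hρ.2])).trans ?_
  refine mul_le_mul_of_nonneg_right ?_ hE0
  have t1 : 16 * exp 1 * ρ ^ 2 ≤ α / 3 := by
    have he : exp 1 < 3 := exp_one_lt_d9.trans (by norm_num)
    calc 16 * exp 1 * ρ ^ 2 ≤ 16 * 3 * (α / 16) ^ 2 := by gcongr; exact hρ.2
      _ ≤ α / 3 := by nlinarith
  have t2 : C * exp K * energy r x₀ u G / ρ ≤ α / 3 := by
    calc C * exp K * energy r x₀ u G / ρ ≤ C * exp K * b / (α / 32) := by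
          gcongr
          · exact hE.trans (min_le_right _ _)
          · exact hρ.1
      _ = α / 3 := by rw [hb]; field_simp; norm_num
  have t3 : C / (K * ρ) ≤ α / 3 := by
    calc C / (K * ρ) ≤ C / (K * (α / 32)) := by gcongr; exact hρ.1
      _ = α / 3 := by rw [hK]; field_simp; norm_num
  linarith
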